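/- Let $K$ be a number field of degree $d=[K:\mathbb Q]$ with set of places $M(K)$. For $v\in M(K)$ let $\|\cdot\|_v$ be the absolute value extending the usual real, complex or $p$-adic one, let $d_v$ be the local degree, and put $|a|_v=\|a\|_v^{d_v/d}$. For a vector $\boldsymbol x=(x_1,\dots,x_m)\in K^m$ define the height $$H(\boldsymbol x)=\prod_{v\in M(K)}H_v(\boldsymbol x),\qquad H_v(\boldsymbol x)=\max_{1\le i\le m}|x_i|_v\ \ (v\nmid\infty),\qquad H_v(\boldsymbol x)=\Big(\sum_{i=1}^m\|x_i\|_v^2\Big)^{d_v/2d}\ \ (v\mid\infty).$$ The height $H(A)$ of a matrix $A$ is the height of the vector of its entries. The height $H(V)$ of a $J$-dimensional subspace $V\subseteq K^N$ is the height of the vector of all $J\times J$ minors of an $N\times J$ matrix whose columns form a basis of $V$ (this does not depend on the basis; in particular $H(\{\boldsymbol 0\})=1$). Let $N\ge 2$, let $F$ be a symmetric bilinear form on $K^N$, and let $Z\subseteq K^N$ be a subspace of dimension $L\ge 1$ such that the bilinear space $(Z,F)$ is regular, i.e. the restriction of $F$ to $Z$ is nondegenerate. Let $\mathcal O(Z,F)$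 be the group of isometries of $(Z,F)$, that is, of linear automorphisms $\sigma$ of $Z$ with $F(\sigma\boldsymbol x,\sigma\boldsymbol y)=F(\boldsymbol x,\boldsymbol y)$ for all $\boldsymbol x,\boldsymbol y\in Z$. For $\sigma\in\mathcal O(Z,F)$ let $H(\sigma)$ be the minimal height of the $N\times N$ matrix of an isometry $\hat\sigma\in\mathcal O(K^N,F)$ that extends $\sigma$. Let $\sigma\in\mathcal O(Z,F)$, let $U=\{\boldsymbol z\in Z:\sigma(\boldsymbol z)=\boldsymbol z\}$ be its invariant subspace, and let $J=\dim_K U$. Then $$H(U)\le\{2H(\sigma)\}^{N-J}\,H(Z).$$ -/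

import Mathlib

open NumberField

noncomputable section

namespace BilinearHeight

variable {K : Type*} [Field K] [NumberField K]

/-- The local height `H_v(x) = (∑ ‖x_i‖_v ^ 2) ^ (d_v / 2d)` of a vector at an infinite place `v`,
where `d = [K : ℚ]` and `d_v` is the local degree (`1` for real, `2` for complex `v`). -/
def infiniteLocalHeight {ι : Type*} [Fintype ι] (v : InfinitePlace K) (x : ι → K) : ℝ :=
  (∑ i, v (x i) ^ 2) ^ ((v.mult : ℝ) / (2 * Module.finrank ℚ K))

/-- The local height `H_v(x) = max_i |x_i|_v` of a vector at a finite place `v`. In Mathlib `v a` is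
the absolute value of `a` normalized by `v π = (N v)⁻¹`, that is `‖a‖_v ^ d_v` for the absolute
value `‖ ‖_v` that extends the `p`-adic one, so that `|a|_v = ‖a‖_v ^ (d_v / d) = (v a) ^ (1 / d)`. -/
def finiteLocalHeight {ι : Type*} [Fintype ι] (v : FinitePlace K) (x : ι → K) : ℝ :=
  ⨆ i, v (x i) ^ ((1 : ℝ) / Module.finrank ℚ K)

/-- The absolute (projective) height `H(x) = ∏_v H_v(x)` of a vector with coordinates in `K`. -/
def vecHeight {ι : Type*} [Fintype ι] (x : ι → K) : ℝ :=
  (∏ v : InfinitePlace K, infiniteLocalHeight v x) * ∏ᶠ v : FinitePlace K, finiteLocalHeight v x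

/-- The height of an `M × N` matrix viewed as a vector in `K ^ (M N)`. -/
def matrixHeight {m n : Type*} [Fintype m] [Fintype n] (A : Matrix m n K) : ℝ :=
  vecHeight (fun p : m × n => A p.1 p.2)

/-- The Grassmann coordinates of an `N × J` matrix `X`: the determinants of the `J × J` submatrices
formed by the rows of `X` with indices in `I`, for all `I ⊆ {1, …, N}` of cardinality `J`. -/
def grassmann {N J : ℕ} (X : Matrix (Fin N) (Fin J) K) (I : Set.powersetCard (Fin N) J) : K :=
  (X.submatrix (Set.powersetCard.ofFinEmbEquiv.symm I) id).det

/-- The height of a subspace `V` of `K ^ N`: the height of the vector of Grassmann coordinates of a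
matrix whose columns form a basis of `V` (by the product formula any basis gives the same value).
The zero subspace has the single Grassmann coordinate `1`, hence height `1`. -/
def subspaceHeight {N : ℕ} (V : Submodule K (Fin N → K)) : ℝ :=
  vecHeight (grassmann (Matrix.of fun (i : Fin N) (j : Fin (Module.finrank K V)) =>
    (Module.finBasis K V j : Fin N → K) i))

/-- `τ` is an isometry of `(K ^ N, F)` that extends the automorphism `σ` of the subspace `Z`. -/
def IsIsometricExtension {N : ℕ} (F : LinearMap.BilinForm K (Fin N → K))
    (Z : Submodule K (Fin N → K)) (σ : Z ≃ₗ[K] Z) (τ : (Fin N → K) ≃ₗ[K] (Fin N → K)) : Prop :=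
  F.IsOrthogonal τ.toLinearMap ∧ ∀ z : Z, τ z = σ z

/-- An isometry of a regular space has an isometric extension, so that the infimum defining its
height is over a nonempty set (of nonnegative reals). -/
theorem exists_isometricExtension {N : ℕ} (F : LinearMap.BilinForm K (Fin N → K))
    (hF : F.IsSymm) (Z : Submodule K (Fin N → K)) (hreg : (F.restrict Z).Nondegenerate)
    (σ : Z ≃ₗ[K] Z) (hσ : (F.restrict Z).IsOrthogonal σ.toLinearMap) :
    ∃ τ : (Fin N → K) ≃ₗ[K] (Fin N → K), IsIsometricExtension F Z σ τ := by
  have hc := LinearMap.BilinForm.isCompl_orthogonal_of_restrict_nondegenerate hF.isRefl hreg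
  let e := Submodule.prodEquivOfIsCompl Z (F.orthogonal Z) hc
  let τ := (e.symm.trans (σ.prodCongr (LinearEquiv.refl K _))).trans e
  have hτ : ∀ p, τ (e p) = e (σ p.1, p.2) := fun p => by simp [τ]
  have he : ∀ p, e p = (p.1 : Fin N → K) + p.2 := fun p => by simp [e]
  have h1 : ∀ (z : Z) (w : F.orthogonal Z), F z w = 0 := fun z w => w.2 z z.2
  have h2 : ∀ (z : Z) (w : F.orthogonal Z), F w z = 0 := fun z w => hF.isRefl _ _ (h1 z w)
  refine ⟨τ, fun x y => ?_, fun z => ?_⟩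
  · obtain ⟨p, rfl⟩ := e.surjective x
    obtain ⟨q, rfl⟩ := e.surjective y
    have h3 : F (σ p.1) (σ q.1) = F p.1 q.1 := hσ p.1 q.1
    rw [LinearEquiv.coe_coe, hτ, hτ]
    simp [he, h1, h2, h3]
  · have := hτ (z, 0)
    simpa [he] using this

/-- The height `H(σ)` of an isometry `σ` of a regular space `(Z, F)`: the least height of the
matrix of an isometry of `(K ^ N, F)` that extends `σ`. -/
def isometryHeight {N : ℕ} (F : LinearMap.BilinForm K (Fin N → K))
    (Z : Submodule K (Fin N → K)) (σ : Z ≃ₗ[K] Z) : ℝ :=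
  sInf {h : ℝ | ∃ τ : (Fin N → K) ≃ₗ[K] (Fin N → K), IsIsometricExtension F Z σ τ ∧
    h = matrixHeight (LinearMap.toMatrix' τ.toLinearMap)}

/-- The invariant subspace `{z ∈ Z : σ z = z}`, as a subspace of `K ^ N`. -/
def invariantSubspace {N : ℕ} (Z : Submodule K (Fin N → K)) (σ : Z ≃ₗ[K] Z) :
    Submodule K (Fin N → K) :=
  (LinearMap.eqLocus σ.toLinearMap LinearMap.id).map Z.subtype

end BilinearHeight

end

noncomputable section

namespace BilinearHeight

open Matrix

/-! Let `A` be the matrix of an isometry `τ` of `K ^ N` extending `σ`. Then `U` is cut out of `Z` by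
the linear forms `l_i`, the rows of `A - 1` (`invariantSubspace_eq`). Cutting `V` with a hyperplane
`l = 0` not containing it lowers the dimension by one and multiplies the height by at most `H(l)`
(`subspaceHeight_inf_ker_le`); a hyperplane containing `V` changes nothing. So exactly `L - J` cuts
count.

Each nonzero `l_i` has height at most `2 H(A)`, provided every local height of `A` is at least 1.
This holds because `τ` preserves a nonzero form: a contraction would give `F x y = F (τ^n x) (τ^n y)
→ 0` (`one_le_of_isOrthogonal`). The form may be degenerate on `K ^ N`, so no determinant argument
is available. Since `2 H(A) ≥ 1`, the exponent may be raised to `N - J`, and the bound passes to the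
infimum over `τ`. -/

/-! ### Gram determinants and contraction at infinite places -/

/-- The Cauchy–Binet formula. -/
theorem det_transpose_mul_eq_sum {R : Type*} [CommRing R] {N J : ℕ}
    (A B : Matrix (Fin N) (Fin J) R) :
    (Aᵀ * B).det = ∑ I : Set.powersetCard (Fin N) J,
      (A.submatrix (Set.powersetCard.ofFinEmbEquiv.symm I) id).det *
        (B.submatrix (Set.powersetCard.ofFinEmbEquiv.symm I) id).det := by
  let b := Pi.basisFun R (Fin N)
  let f : Fin J → Module.Dual R (Fin N → R) := fun j => dotProductBilin R R (Aᵀ j)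
  let x := exteriorPower.ιMulti R J (fun j => Bᵀ j)
  have h1 : exteriorPower.pairingDual R _ J (exteriorPower.ιMulti R J f) x = (Aᵀ * B).det := by
    rw [exteriorPower.pairingDual_ιMulti_ιMulti, ← det_transpose]
    congr 1
  rw [← h1, ← (b.exteriorPower J).sum_repr x, map_sum]
  refine Finset.sum_congr rfl fun I _ => ?_
  rw [map_smul, exteriorPower.basis_repr_apply, exteriorPower.ιMultiDual_apply_ιMulti,
    exteriorPower.basis_apply, exteriorPower.ιMulti_family,
    exteriorPower.pairingDual_ιMulti_ιMulti, smul_eq_mul, mul_comm]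
  congr 1
  · congr 1
    ext i j
    simp [f, b]
  · rw [← det_transpose]
    congr 1

theorem sum_norm_minor_sq {N J : ℕ} (X : Matrix (Fin N) (Fin J) ℂ) :
    ((∑ I : Set.powersetCard (Fin N) J,
      ‖(X.submatrix (Set.powersetCard.ofFinEmbEquiv.symm I) id).det‖ ^ 2 : ℝ) : ℂ) =
      (Xᴴ * X).det := by
  have h := det_transpose_mul_eq_sum (X.map star) X
  rw [conjTranspose, transpose_map, h]
  push_cast
  refine Finset.sum_congr rfl fun I _ => ?_
  rw [← Complex.conj_mul', ← Complex.star_def, submatrix_map]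
  congr 1
  exact (starRingEnd ℂ).map_det _

/-- By orthogonality the first row of the Gram matrix vanishes off the diagonal, so the Laplace
expansion along it has one term. -/
theorem det_conjTranspose_mul_self_of_orthogonal {N k : ℕ} (X : Matrix (Fin N) (Fin (k + 1)) ℂ)
    (h : ∀ j : Fin k, star (X.col 0) ⬝ᵥ X.col j.succ = 0) :
    (Xᴴ * X).det =
      (star (X.col 0) ⬝ᵥ X.col 0) *
        ((X.submatrix id Fin.succ)ᴴ * X.submatrix id Fin.succ).det := by
  rw [det_succ_row_zero, Fin.sum_univ_succ, Finset.sum_eq_zero, add_zero]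
  · simp only [Fin.val_zero, pow_zero, one_mul]
    rfl
  · intro j _
    have : (Xᴴ * X) 0 j.succ = 0 := h j
    simp [this]

/-- The effect on the Euclidean norm of the vector of minors of contracting with a linear form. -/
theorem sum_norm_minor_sq_tail_le {N k : ℕ} (X : Matrix (Fin N) (Fin (k + 1)) ℂ) (l : Fin N → ℂ)
    (hl : l ᵥ* X = Pi.single 0 1) :
    ∑ I : Set.powersetCard (Fin N) k,
        ‖((X.submatrix id Fin.succ).submatrix
          (Set.powersetCard.ofFinEmbEquiv.symm I) id).det‖ ^ 2 ≤
      (∑ i, ‖l i‖ ^ 2) * ∑ I : Set.powersetCard (Fin N) (k + 1),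
        ‖(X.submatrix (Set.powersetCard.ofFinEmbEquiv.symm I) id).det‖ ^ 2 := by
  let u : Fin (k + 1) → EuclideanSpace ℂ (Fin N) := fun j => WithLp.toLp 2 (X.col j)
  let S := Submodule.span ℂ (Set.range fun j : Fin k => u j.succ)
  obtain ⟨c, hc⟩ := (Submodule.mem_span_range_iff_exists_fun ℂ).1
    (S.starProjection_apply_mem (u 0))
  -- The part of the first column orthogonal to the others; `T` is the unimodular column operation
  -- that puts it in place.
  let w : EuclideanSpace ℂ (Fin N) := u 0 - S.starProjection (u 0)
  have hw : ∀ i, w i = X i 0 - ∑ j, c j * X i j.succ := fun i => by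
    simp [w, ← hc, u]
  let T : Matrix (Fin (k + 1)) (Fin (k + 1)) ℂ :=
    (1 : Matrix _ _ ℂ).updateCol 0 (Fin.cons 1 fun j => - c j)
  have hT : T.det = 1 := by
    rw [det_succ_row_zero, Fin.sum_univ_succ, Finset.sum_eq_zero, add_zero]
    · have h1 : T.submatrix Fin.succ (Fin.succAbove 0) = 1 := by
        ext i j
        simp [T, one_apply]
      rw [h1, det_one]
      simp [T]
    · intro j _
      simp [T, one_apply, (Fin.succ_ne_zero j).symm]
  have h0 : (X * T).col 0 = w.ofLp := by
    ext i
    simp [hw, T, mul_apply, Fin.sum_univ_succ, sub_eq_add_neg, mul_comm]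
  have hs : (X * T).submatrix id Fin.succ = X.submatrix id Fin.succ := by
    ext i j
    simp [T, mul_apply, one_apply]
  have hdet : (Xᴴ * X).det = ((X * T)ᴴ * (X * T)).det := by
    rw [conjTranspose_mul, ← Matrix.mul_assoc, det_mul, hT, Matrix.mul_assoc, det_mul,
      det_conjTranspose, hT]
    simp
  have horth := det_conjTranspose_mul_self_of_orthogonal (X * T) fun j => by
    have h1 : (X * T).col j.succ = X.col j.succ := by
      ext i
      exact congrFun (congrFun hs i) j
    rw [h0, h1, dotProduct_comm]
    have h2 : u j.succ ∈ S := Submodule.subset_span ⟨j, rfl⟩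
    have h3 : inner ℂ w (u j.succ) = 0 :=
      Submodule.inner_left_of_mem_orthogonal h2 (S.sub_starProjection_mem_orthogonal (u 0))
    exact h3
  rw [hs, h0, ← hdet] at horth
  have hww : star w.ofLp ⬝ᵥ w.ofLp = ((∑ i, ‖w i‖ ^ 2 : ℝ) : ℂ) := by
    push_cast
    exact Finset.sum_congr rfl fun i _ => Complex.conj_mul' _
  rw [hww, ← sum_norm_minor_sq, ← sum_norm_minor_sq] at horth
  norm_cast at horth
  rw [horth, ← mul_assoc]
  -- What remains is `1 ≤ |l|² |w|²`: as `l` kills the other columns, `l · w = 1`, and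
  -- Cauchy–Schwarz applies.
  refine le_mul_of_one_le_left (by positivity) ?_
  have hlw : ∑ i, l i * w i = 1 := by
    have h4 : ∀ j, ∑ i, l i * X i j = (Pi.single 0 1 : Fin (k + 1) → ℂ) j := fun j =>
      congrFun hl j
    simp only [hw, mul_sub, Finset.sum_sub_distrib, h4, Finset.mul_sum]
    rw [Finset.sum_comm]
    simp only [mul_left_comm (l _), ← Finset.mul_sum, h4]
    simp
  have h5 : (1 : ℝ) ≤ ∑ i, ‖l i‖ * ‖w i‖ := by
    calc (1 : ℝ) = ‖∑ i, l i * w i‖ := by simp [hlw]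
      _ ≤ _ := (norm_sum_le _ _).trans_eq (by simp)
  calc (1 : ℝ) ≤ (∑ i, ‖l i‖ * ‖w i‖) ^ 2 := one_le_pow₀ h5
    _ ≤ _ := Finset.sum_mul_sq_le_sq_mul_sq _ _ _

variable {K : Type*} [Field K] [NumberField K]

theorem infiniteLocalHeight_contract_le {N k : ℕ} (v : InfinitePlace K)
    (X : Matrix (Fin N) (Fin (k + 1)) K) (l : Fin N → K) (hl : l ᵥ* X = Pi.single 0 1) :
    infiniteLocalHeight v (grassmann (X.submatrix id Fin.succ)) ≤
      infiniteLocalHeight v l * infiniteLocalHeight v (grassmann X) := by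
  unfold infiniteLocalHeight
  rw [← Real.mul_rpow (by positivity) (by positivity)]
  refine Real.rpow_le_rpow (by positivity) ?_ (by positivity)
  have h := sum_norm_minor_sq_tail_le (X.map v.embedding) (v.embedding ∘ l) (by
    ext j
    have := congrArg v.embedding (congrFun hl j)
    simp only [vecMul, dotProduct, map_sum, map_mul] at this
    simp only [vecMul, dotProduct, Function.comp_apply, map_apply, this]
    by_cases hj : j = 0 <;> simp [hj])
  simp only [← InfinitePlace.norm_embedding_eq, grassmann, RingHom.map_det]
  exact h

/-! ### Finite places and comparison of global heights -/

/-- The absolute value `|a|_v = ‖a‖_v ^ (d_v / d)` at a finite place. -/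
def finiteAbs (v : FinitePlace K) : AbsoluteValue K ℝ where
  toFun a := v a ^ ((1 : ℝ) / Module.finrank ℚ K)
  map_mul' a b := by rw [map_mul, Real.mul_rpow (apply_nonneg v a) (apply_nonneg v b)]
  nonneg' a := Real.rpow_nonneg (apply_nonneg v a) _
  eq_zero' a := by
    have hd : (1 : ℝ) / Module.finrank ℚ K ≠ 0 := by
      have := Module.finrank_pos (R := ℚ) (M := K)
      positivity
    rw [Real.rpow_eq_zero (apply_nonneg v a) hd]
    exact v.1.eq_zero
  add_le' a b := by
    have h := Real.rpow_le_rpow (apply_nonneg v _) (v.add_le a b)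
      (show (0 : ℝ) ≤ (1 : ℝ) / Module.finrank ℚ K by positivity)
    have h1 := Real.rpow_nonneg (apply_nonneg v a) ((1 : ℝ) / Module.finrank ℚ K)
    have h2 := Real.rpow_nonneg (apply_nonneg v b) ((1 : ℝ) / Module.finrank ℚ K)
    rcases le_total (v a) (v b) with hab | hab
    · rw [max_eq_right hab] at h
      linarith
    · rw [max_eq_left hab] at h
      linarith

theorem isNonarchimedean_finiteAbs (v : FinitePlace K) : IsNonarchimedean (finiteAbs v) := by
  intro a b
  have h := Real.rpow_le_rpow (apply_nonneg v _) (v.add_le a b)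
    (show (0 : ℝ) ≤ (1 : ℝ) / Module.finrank ℚ K by positivity)
  rcases le_total (v a) (v b) with hab | hab
  · rw [max_eq_right hab] at h
    exact h.trans (le_max_right _ _)
  · rw [max_eq_left hab] at h
    exact h.trans (le_max_left _ _)

theorem finiteAbs_sum_le (v : FinitePlace K) {ι : Type*} (s : Finset ι) (f : ι → K) {B : ℝ}
    (hB : 0 ≤ B) (h : ∀ i ∈ s, finiteAbs v (f i) ≤ B) : finiteAbs v (∑ i ∈ s, f i) ≤ B := by
  classical
  induction s using Finset.induction_on with
  | empty => simpa using hB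
  | insert a s ha ih =>
    rw [Finset.sum_insert ha]
    exact (isNonarchimedean_finiteAbs v _ _).trans
      (max_le (h a (by simp)) (ih fun i hi => h i (by simp [hi])))

section

variable {ι : Type*} [Fintype ι]

theorem finiteAbs_le_finiteLocalHeight (v : FinitePlace K) (x : ι → K) (i : ι) :
    finiteAbs v (x i) ≤ finiteLocalHeight v x :=
  le_ciSup (f := fun i => finiteAbs v (x i)) (Set.finite_range _).bddAbove i

theorem finiteLocalHeight_le (v : FinitePlace K) (x : ι → K) {B : ℝ} (hB : 0 ≤ B)
    (h : ∀ i, finiteAbs v (x i) ≤ B) : finiteLocalHeight v x ≤ B :=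
  Real.iSup_le h hB

theorem finiteLocalHeight_nonneg (v : FinitePlace K) (x : ι → K) : 0 ≤ finiteLocalHeight v x :=
  Real.iSup_nonneg fun i => (finiteAbs v).nonneg (x i)

theorem infiniteLocalHeight_nonneg (v : InfinitePlace K) (x : ι → K) :
    0 ≤ infiniteLocalHeight v x := by
  unfold infiniteLocalHeight
  positivity

theorem vecHeight_nonneg (x : ι → K) : 0 ≤ vecHeight x :=
  mul_nonneg (Finset.prod_nonneg fun v _ => infiniteLocalHeight_nonneg v x)
    (finprod_nonneg fun v => finiteLocalHeight_nonneg v x)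

theorem hasFiniteMulSupport_finiteAbs {a : K} (ha : a ≠ 0) :
    (fun v : FinitePlace K => finiteAbs v a).HasFiniteMulSupport :=
  (FinitePlace.hasFiniteMulSupport ha).fun_comp (g := fun t : ℝ => t ^ ((1 : ℝ) / _))
    (Real.one_rpow _)

theorem hasFiniteMulSupport_finiteLocalHeight {x : ι → K} (hx : x ≠ 0) :
    (fun v : FinitePlace K => finiteLocalHeight v x).HasFiniteMulSupport := by
  -- Zero coordinates must be dropped: each contributes the constant function 0, whose
  -- multiplicative support is infinite.
  have : Nonempty {j // x j ≠ 0} := nonempty_subtype.mpr <| Function.ne_iff.mp hx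
  have h : (fun v : FinitePlace K => ⨆ i : {j // x j ≠ 0}, finiteAbs v (x i)).HasFiniteMulSupport :=
    .iSup fun i => hasFiniteMulSupport_finiteAbs i.2
  convert h using 2 with v
  have hb : BddAbove (Set.range fun i : {j // x j ≠ 0} => finiteAbs v (x i)) :=
    (Set.finite_range _).bddAbove
  have h0 : 0 ≤ ⨆ i : {j // x j ≠ 0}, finiteAbs v (x i) :=
    Real.iSup_nonneg fun i => (finiteAbs v).nonneg _
  refine le_antisymm (finiteLocalHeight_le v x h0 fun j => ?_)
    (ciSup_le fun j => finiteAbs_le_finiteLocalHeight v x j)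
  by_cases hj : x j = 0
  · rwa [hj, map_zero]
  · exact le_ciSup hb ⟨j, hj⟩

theorem finiteLocalHeight_smul (v : FinitePlace K) (c : K) (x : ι → K) :
    finiteLocalHeight v (c • x) = finiteAbs v c * finiteLocalHeight v x := by
  refine (iSup_congr fun i => ?_).trans
    (Real.mul_iSup_of_nonneg ((finiteAbs v).nonneg c) _).symm
  exact (finiteAbs v).map_mul c (x i)

theorem infiniteLocalHeight_smul (v : InfinitePlace K) (c : K) (x : ι → K) :
    infiniteLocalHeight v (c • x) =
      (v c ^ v.mult) ^ ((1 : ℝ) / Module.finrank ℚ K) * infiniteLocalHeight v x := by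
  unfold infiniteLocalHeight
  have h : (v c ^ v.mult) ^ ((1 : ℝ) / Module.finrank ℚ K) =
      (v c ^ 2) ^ ((v.mult : ℝ) / (2 * Module.finrank ℚ K)) := by
    rw [← Real.rpow_natCast, ← Real.rpow_natCast, ← Real.rpow_mul (apply_nonneg v c),
      ← Real.rpow_mul (apply_nonneg v c)]
    congr 1
    push_cast
    have := Module.finrank_pos (R := ℚ) (M := K)
    field_simp
  rw [h, ← Real.mul_rpow (by positivity) (by positivity), Finset.mul_sum]
  congr 1
  exact Finset.sum_congr rfl fun i _ => by simp [mul_pow]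

/-- This is the product formula for `c`, raised to the power `1 / d`. -/
theorem vecHeight_smul {c : K} (hc : c ≠ 0) {x : ι → K} (hx : x ≠ 0) :
    vecHeight (c • x) = vecHeight x := by
  have h := congrArg (fun t : ℝ => t ^ ((1 : ℝ) / Module.finrank ℚ K)) (prod_abs_eq_one hc)
  have h1 : ∏ᶠ v : FinitePlace K, finiteAbs v c =
      (∏ᶠ v : FinitePlace K, v c) ^ ((1 : ℝ) / Module.finrank ℚ K) := by
    have hs : (fun v : FinitePlace K => v c).mulSupport.Finite :=
      FinitePlace.hasFiniteMulSupport hc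
    rw [finprod_eq_prod_of_mulSupport_toFinset_subset _ hs (s := hs.toFinset) subset_rfl,
      ← Real.finsetProd_rpow _ _ fun v _ => apply_nonneg v c]
    refine finprod_eq_finsetProd_of_mulSupport_subset _ fun v hv => ?_
    simp only [Set.Finite.coe_toFinset, Function.mem_mulSupport] at hv ⊢
    intro h1
    exact hv (by simp [finiteAbs, h1])
  simp only [Real.one_rpow] at h
  rw [Real.mul_rpow (by positivity) (finprod_nonneg fun v => apply_nonneg v c), ← h1,
    ← Real.finsetProd_rpow _ _ fun v _ => by positivity] at h
  unfold vecHeight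
  simp only [finiteLocalHeight_smul, infiniteLocalHeight_smul, Finset.prod_mul_distrib]
  rw [finprod_mul_distrib (hasFiniteMulSupport_finiteAbs hc)
    (hasFiniteMulSupport_finiteLocalHeight hx), mul_mul_mul_comm, h, one_mul]

theorem vecHeight_le_mul {κ μ : Type*} [Fintype κ] [Fintype μ] {x : ι → K} {y : κ → K} {z : μ → K}
    (hx : x ≠ 0) (hy : y ≠ 0) (hz : z ≠ 0)
    (hi : ∀ v, infiniteLocalHeight v x ≤ infiniteLocalHeight v y * infiniteLocalHeight v z)
    (hf : ∀ v, finiteLocalHeight v x ≤ finiteLocalHeight v y * finiteLocalHeight v z) :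
    vecHeight x ≤ vecHeight y * vecHeight z := by
  have h1 := hasFiniteMulSupport_finiteLocalHeight hy
  have h2 := hasFiniteMulSupport_finiteLocalHeight hz
  unfold vecHeight
  rw [mul_mul_mul_comm, ← Finset.prod_mul_distrib, ← finprod_mul_distrib h1 h2]
  refine mul_le_mul
    (Finset.prod_le_prod (fun v _ => infiniteLocalHeight_nonneg v x) fun v _ => hi v)
    (finprod_le_finprod (hasFiniteMulSupport_finiteLocalHeight hx)
      (fun v => finiteLocalHeight_nonneg v x) (h1.mul h2) hf)
    (finprod_nonneg fun v => finiteLocalHeight_nonneg v x)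
    (Finset.prod_nonneg fun v _ => mul_nonneg (infiniteLocalHeight_nonneg v y)
      (infiniteLocalHeight_nonneg v z))

/-- Since the local degrees at infinity sum to `d`, a factor `c` at every infinite place costs
exactly `c` globally. -/
theorem prod_infinite_rpow_mult {c : ℝ} (hc : 0 ≤ c) :
    ∏ v : InfinitePlace K, (c ^ 2) ^ ((v.mult : ℝ) / (2 * Module.finrank ℚ K)) = c := by
  have hd := Module.finrank_pos (R := ℚ) (M := K)
  rw [← Real.rpow_sum_of_nonneg (by positivity) fun v _ => by positivity, ← Finset.sum_div,
    ← Nat.cast_sum, InfinitePlace.sum_mult_eq, ← Real.rpow_natCast, ← Real.rpow_mul hc]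
  have : ((2 : ℕ) : ℝ) * ((Module.finrank ℚ K : ℝ) / (2 * Module.finrank ℚ K)) = 1 := by
    push_cast
    field_simp
  rw [this, Real.rpow_one]

theorem vecHeight_le_const_mul {κ : Type*} [Fintype κ] {x : ι → K} {y : κ → K} {c : ℝ}
    (hc : 0 ≤ c) (hx : x ≠ 0) (hy : y ≠ 0)
    (hi : ∀ v : InfinitePlace K, ∑ i, v (x i) ^ 2 ≤ c ^ 2 * ∑ i, v (y i) ^ 2)
    (hf : ∀ v, finiteLocalHeight v x ≤ finiteLocalHeight v y) :
    vecHeight x ≤ c * vecHeight y := by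
  unfold vecHeight
  rw [← mul_assoc]
  refine mul_le_mul ?_ (finprod_le_finprod (hasFiniteMulSupport_finiteLocalHeight hx)
      (fun v => finiteLocalHeight_nonneg v x) (hasFiniteMulSupport_finiteLocalHeight hy) hf)
    (finprod_nonneg fun v => finiteLocalHeight_nonneg v x)
    (mul_nonneg hc (Finset.prod_nonneg fun v _ => infiniteLocalHeight_nonneg v y))
  conv_rhs => rw [← prod_infinite_rpow_mult (K := K) hc, ← Finset.prod_mul_distrib]
  refine Finset.prod_le_prod (fun v _ => infiniteLocalHeight_nonneg v x) fun v _ => ?_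
  unfold infiniteLocalHeight
  rw [← Real.mul_rpow (by positivity) (by positivity)]
  exact Real.rpow_le_rpow (by positivity) (hi v) (by positivity)

theorem one_le_vecHeight {x : ι → K} (hx : x ≠ 0)
    (hi : ∀ v : InfinitePlace K, 1 ≤ ∑ i, v (x i) ^ 2) (hf : ∀ v, 1 ≤ finiteLocalHeight v x) :
    1 ≤ vecHeight x := by
  have h1 : ∏ᶠ _ : FinitePlace K, (1 : ℝ) ≤ ∏ᶠ v : FinitePlace K, finiteLocalHeight v x :=
    finprod_le_finprod (by simp [Function.HasFiniteMulSupport]) (fun _ => zero_le_one)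
      (hasFiniteMulSupport_finiteLocalHeight hx) hf
  rw [finprod_one] at h1
  have h2 : ∏ _v : InfinitePlace K, (1 : ℝ) ≤ ∏ v : InfinitePlace K, infiniteLocalHeight v x :=
    Finset.prod_le_prod (fun _ _ => zero_le_one)
      fun v _ => Real.one_le_rpow (hi v) (by positivity)
  rw [Finset.prod_const_one] at h2
  exact one_le_mul_of_one_le_of_one_le h2 h1

end

/-! ### Minors and contraction at finite places -/

/-- A repeated row gives determinant 0; distinct rows give a Grassmann coordinate up to sign. -/
theorem finiteAbs_minor_le {N J : ℕ} (v : FinitePlace K) (X : Matrix (Fin N) (Fin J) K)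
    (f : Fin J → Fin N) :
    finiteAbs v (X.submatrix f id).det ≤ finiteLocalHeight v (grassmann X) := by
  by_cases hf : f.Injective
  · let I : Set.powersetCard (Fin N) J := Set.powersetCard.ofFinEmb J (Fin N) ⟨f, hf⟩
    let e := Set.powersetCard.ofFinEmbEquiv.symm I
    have he : ∀ i, ∃ j, e j = f i := fun i => by
      have : f i ∈ Set.range e :=
        (Set.powersetCard.mem_range_ofFinEmbEquiv_symm_iff_mem I _).2
          ((Set.powersetCard.mem_ofFinEmb_iff_mem_range _ _ _ _).2 ⟨i, rfl⟩)
      exact this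
    choose g hg using he
    have hgi : g.Injective := fun i j hij => hf (by rw [← hg, ← hg, hij])
    let s := Equiv.ofBijective g (Finite.injective_iff_bijective.1 hgi)
    have h1 : X.submatrix f id = (X.submatrix e id).submatrix s id := by
      ext i j
      simp [s, hg]
    rw [h1, det_permute, map_mul]
    have h2 : finiteAbs v ((Equiv.Perm.sign s : ℤ) : K) = 1 := by
      rcases Int.units_eq_one_or (Equiv.Perm.sign s) with h | h <;> simp [h]
    rw [h2, one_mul]
    exact finiteAbs_le_finiteLocalHeight v (grassmann X) I
  · obtain ⟨i, j, hij, hne⟩ := Function.not_injective_iff.1 hf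
    rw [det_zero_of_row_eq hne (by ext; simp [hij]), map_zero]
    exact finiteLocalHeight_nonneg v _

theorem finiteLocalHeight_contract_le {N k : ℕ} (v : FinitePlace K)
    (X : Matrix (Fin N) (Fin (k + 1)) K) (l : Fin N → K) (hl : l ᵥ* X = Pi.single 0 1) :
    finiteLocalHeight v (grassmann (X.submatrix id Fin.succ)) ≤
      finiteLocalHeight v l * finiteLocalHeight v (grassmann X) := by
  have h0 := mul_nonneg (finiteLocalHeight_nonneg v l) (finiteLocalHeight_nonneg v (grassmann X))
  refine finiteLocalHeight_le v _ h0 fun I => ?_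
  let e := Set.powersetCard.ofFinEmbEquiv.symm I
  let M : Fin N → Matrix (Fin (k + 1)) (Fin (k + 1)) K := fun i =>
    X.submatrix (Fin.cons i e : Fin (k + 1) → Fin N) id
  -- Expand each `M i` along its top row, row `i` of `X`. Weighting by `l i` and summing leaves only
  -- the first cofactor, since `l` sends the columns to `1, 0, …, 0`.
  have h1 : grassmann (X.submatrix id Fin.succ) I = ∑ i, l i * (M i).det := by
    have h2 : ∀ i, (M i).det = ∑ j : Fin (k + 1), (-1) ^ (j : ℕ) * X i j *
        (X.submatrix e j.succAbove).det := fun i => by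
      rw [det_succ_row_zero]
      rfl
    have h3 : ∀ j, ∑ i, l i * X i j = (Pi.single 0 1 : Fin (k + 1) → K) j := fun j =>
      congrFun hl j
    have h4 : ∀ j : Fin (k + 1), ∑ i, l i * ((-1) ^ (j : ℕ) * X i j *
        (X.submatrix e j.succAbove).det) = (Pi.single 0 1 : Fin (k + 1) → K) j *
          ((-1) ^ (j : ℕ) * (X.submatrix e j.succAbove).det) := fun j => by
      rw [← h3, Finset.sum_mul]
      exact Finset.sum_congr rfl fun i _ => by ring
    simp only [h2, Finset.mul_sum]
    rw [Finset.sum_comm]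
    simp only [h4]
    rw [Fin.sum_univ_succ]
    simp only [Pi.single_eq_same, Pi.single_eq_of_ne (Fin.succ_ne_zero _), zero_mul,
      Finset.sum_const_zero, add_zero, Fin.val_zero, pow_zero, one_mul]
    rfl
  rw [h1]
  refine finiteAbs_sum_le v _ _ h0 fun i _ => ?_
  rw [map_mul]
  exact mul_le_mul (finiteAbs_le_finiteLocalHeight v l i) (finiteAbs_minor_le v X _)
    ((finiteAbs v).nonneg _) (finiteLocalHeight_nonneg v l)

/-! ### Heights of subspaces and hyperplane sections -/

theorem grassmann_mul {k : Type*} [Field k] {N J : ℕ} (X : Matrix (Fin N) (Fin J) k)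
    (T : Matrix (Fin J) (Fin J) k) :
    grassmann (X * T) = T.det • grassmann X := by
  ext I
  simp only [grassmann, Pi.smul_apply, smul_eq_mul]
  rw [mul_comm, ← det_mul]
  rfl

/-- For a left inverse `G` of `X`, Cauchy–Binet writes `1 = det (G X)` as a combination of the
minors of `X`. -/
theorem grassmann_ne_zero {N J : ℕ} {X : Matrix (Fin N) (Fin J) K}
    (hX : LinearIndependent K X.col) : grassmann X ≠ 0 := by
  obtain ⟨g, hg⟩ := X.mulVecLin.exists_leftInverse_of_injective
    (LinearMap.ker_eq_bot.2 (mulVec_injective_iff.2 hX))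
  have h : LinearMap.toMatrix' g * X = 1 := by
    have := congrArg LinearMap.toMatrix' hg
    rwa [LinearMap.toMatrix'_comp, LinearMap.toMatrix'_id, ← toLin'_apply',
      LinearMap.toMatrix'_toLin'] at this
  intro h0
  have h1 := det_transpose_mul_eq_sum (LinearMap.toMatrix' g)ᵀ X
  rw [transpose_transpose, h, det_one, Finset.sum_eq_zero] at h1
  · exact one_ne_zero h1
  · intro I _
    rw [show (X.submatrix _ id).det = 0 from congrFun h0 I, mul_zero]

/-- The matrix whose columns are the vectors of a basis of a subspace of `K ^ N`. -/
def basisMatrix {N J : ℕ} {V : Submodule K (Fin N → K)} (b : Module.Basis (Fin J) K V) :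
    Matrix (Fin N) (Fin J) K :=
  of fun i j => (b j : Fin N → K) i

theorem grassmann_basisMatrix_ne_zero {N J : ℕ} {V : Submodule K (Fin N → K)}
    (b : Module.Basis (Fin J) K V) : grassmann (basisMatrix b) ≠ 0 :=
  grassmann_ne_zero (b.linearIndependent.map' V.subtype V.ker_subtype)

/-- The height of a subspace may be computed with any basis. -/
theorem subspaceHeight_eq {N J : ℕ} {V : Submodule K (Fin N → K)} (b : Module.Basis (Fin J) K V) :
    subspaceHeight V = vecHeight (grassmann (basisMatrix b)) := by
  obtain rfl : Module.finrank K V = J := by simpa using Module.finrank_eq_card_basis b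
  let b' := Module.finBasis K V
  have h : basisMatrix b' = basisMatrix b * b.toMatrix b' := by
    ext i j
    have := congrArg (fun x : V => (x : Fin N → K) i) (b.sum_toMatrix_smul_self b' j)
    simp only [AddSubmonoidClass.coe_finsetSum, Finset.sum_apply, SetLike.val_smul,
      Pi.smul_apply, smul_eq_mul] at this
    simp only [basisMatrix, mul_apply, of_apply, ← this, mul_comm]
  have hu : (b.toMatrix b').det ≠ 0 := (b.isUnit_det b').ne_zero
  change vecHeight (grassmann (basisMatrix b')) = _
  rw [h, grassmann_mul, vecHeight_smul hu (grassmann_basisMatrix_ne_zero b)]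

theorem subspaceHeight_nonneg {N : ℕ} (V : Submodule K (Fin N → K)) : 0 ≤ subspaceHeight V :=
  vecHeight_nonneg _

/-- Cutting a subspace with a hyperplane. -/
theorem subspaceHeight_inf_ker_le {N : ℕ} (V : Submodule K (Fin N → K)) (l : Fin N → K)
    {y : Fin N → K} (hy : y ∈ V) (hly : l ⬝ᵥ y ≠ 0) :
    Module.finrank K ↥(V ⊓ LinearMap.ker (dotProductBilin K K l)) + 1 = Module.finrank K V ∧
      subspaceHeight (V ⊓ LinearMap.ker (dotProductBilin K K l)) ≤
        vecHeight l * subspaceHeight V := by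
  set W := V ⊓ LinearMap.ker (dotProductBilin K K l) with hW
  have hWl : ∀ x ∈ W, l ⬝ᵥ x = 0 := fun x hx => hx.2
  -- Normalized so that `l · y' = 1`; then `z - (l · z) y'` lies in `W` for `z ∈ V`, so `y'` and a
  -- basis of `W` form a basis of `V`.
  let y' := (l ⬝ᵥ y)⁻¹ • y
  have hly' : l ⬝ᵥ y' = 1 := by simp [y', hly]
  have hyV : y' ∈ V := V.smul_mem _ hy
  let b := Module.finBasis K W
  let B := Module.Basis.mkFinConsOfLE y' hyV b inf_le_left
    (fun c x hx h => by
      have := congrArg (l ⬝ᵥ ·) h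
      simpa [hly', hWl x hx] using this)
    (fun z hz => ⟨-(l ⬝ᵥ z), V.add_mem hz (V.smul_mem _ hyV), by
      change l ⬝ᵥ (z + -(l ⬝ᵥ z) • y') = 0
      simp [hly']⟩)
  refine ⟨by simpa using (Module.finrank_eq_card_basis B).symm, ?_⟩
  have hB0 : (B 0 : Fin N → K) = y' := by simp [B]
  have hBs : ∀ j, (B (Fin.succ j) : Fin N → K) = b j := fun j => by simp [B]
  have hsub : (basisMatrix B).submatrix id Fin.succ = basisMatrix b := by
    ext i j
    exact congrFun (hBs j) i
  have hl : l ᵥ* basisMatrix B = Pi.single 0 1 := by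
    ext j
    change l ⬝ᵥ (B j : Fin N → K) = _
    refine Fin.cases ?_ (fun j => ?_) j
    · simp [hB0, hly']
    · simp [hBs, hWl _ (b j).2]
  have hl0 : l ≠ 0 := by
    rintro rfl
    simp at hly
  rw [subspaceHeight_eq b, subspaceHeight_eq B]
  refine vecHeight_le_mul (grassmann_basisMatrix_ne_zero b) hl0 (grassmann_basisMatrix_ne_zero B)
    (fun v => ?_) fun v => ?_
  · rw [← hsub]
    exact infiniteLocalHeight_contract_le v _ l hl
  · rw [← hsub]
    exact finiteLocalHeight_contract_le v _ l hl

/-- Here `m` counts the hyperplanes that really cut; only those contribute a factor `C`, and their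
forms are nonzero. -/
theorem subspaceHeight_inf_iInf_ker_le {N : ℕ} (V : Submodule K (Fin N → K)) {ι : Type*}
    (l : ι → Fin N → K) {C : ℝ} (hC : ∀ i, l i ≠ 0 → vecHeight (l i) ≤ C)
    (s : Finset ι) :
    ∃ m, Module.finrank K ↥(V ⊓ s.inf fun i => LinearMap.ker (dotProductBilin K K (l i))) + m =
        Module.finrank K V ∧
      subspaceHeight (V ⊓ s.inf fun i => LinearMap.ker (dotProductBilin K K (l i))) ≤
        C ^ m * subspaceHeight V := by
  classical
  induction s using Finset.induction_on with
  | empty =>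
    rw [Finset.inf_empty, inf_top_eq]
    exact ⟨0, by simp⟩
  | insert a s ha ih =>
    obtain ⟨m, hm, hle⟩ := ih
    rw [Finset.inf_insert, inf_comm (LinearMap.ker _), ← inf_assoc]
    set W := V ⊓ s.inf fun i => LinearMap.ker (dotProductBilin K K (l i))
    by_cases h : ∃ y ∈ W, l a ⬝ᵥ y ≠ 0
    · obtain ⟨y, hy, hly⟩ := h
      obtain ⟨h1, h2⟩ := subspaceHeight_inf_ker_le W (l a) hy hly
      have h3 : vecHeight (l a) ≤ C := hC a (by rintro h0; simp [h0] at hly)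
      refine ⟨m + 1, by omega, h2.trans ?_⟩
      rw [pow_succ', mul_assoc]
      exact mul_le_mul h3 hle (subspaceHeight_nonneg _) ((vecHeight_nonneg _).trans h3)
    · push Not at h
      have h1 : W ⊓ LinearMap.ker (dotProductBilin K K (l a)) = W := inf_eq_left.2 h
      rw [h1]
      exact ⟨m, hm, hle⟩

/-! ### Local heights of an isometry are at least 1 -/

/-- A nonzero bilinear form has no isometry that contracts with respect to an absolute value. -/
theorem one_le_of_isOrthogonal {k : Type*} [Field k] {N : ℕ} (w : AbsoluteValue k ℝ)
    (F : LinearMap.BilinForm k (Fin N → k)) (hF : F ≠ 0)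
    (τ : (Fin N → k) →ₗ[k] (Fin N → k)) (hτ : F.IsOrthogonal τ)
    (p : (Fin N → k) → ℝ) (hp : ∀ x i, w (x i) ≤ p x) (hp0 : ∀ x, 0 ≤ p x) {r : ℝ} (hr : 0 ≤ r)
    (h : ∀ x, p (τ x) ≤ r * p x) : 1 ≤ r := by
  by_contra! hlt
  obtain ⟨x, y, hxy⟩ : ∃ x y, F x y ≠ 0 := by
    by_contra! h0
    exact hF (LinearMap.ext₂ h0)
  -- The sum of the sizes of the entries of the Gram matrix, so that `|F a b| ≤ C p(a) p(b)`.
  let C := ∑ i, ∑ j, w (F (Pi.single i 1) (Pi.single j 1))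
  have hC : ∀ a b, w (F a b) ≤ C * (p a * p b) := fun a b => by
    have h1 : F a b = ∑ i, ∑ j, a i * (b j * F (Pi.single i 1) (Pi.single j 1)) := by
      conv_lhs => rw [← LinearMap.sum_repr_mul_repr_mul (Pi.basisFun k (Fin N))
        (Pi.basisFun k (Fin N))]
      simp [Finsupp.sum_fintype]
    rw [h1, Finset.sum_mul]
    refine (w.sum_le _ _).trans (Finset.sum_le_sum fun i _ => ?_)
    rw [Finset.sum_mul]
    refine (w.sum_le _ _).trans (Finset.sum_le_sum fun j _ => ?_)
    rw [map_mul, map_mul, ← mul_assoc, mul_comm]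
    exact mul_le_mul_of_nonneg_left
      (mul_le_mul (hp a i) (hp b j) (w.nonneg _) (hp0 a)) (w.nonneg _)
  have hpow : ∀ n x, p ((τ ^ n) x) ≤ r ^ n * p x := fun n => by
    induction n with
    | zero => simp
    | succ n ih =>
      intro x
      rw [pow_succ', pow_succ', mul_assoc]
      exact (h _).trans (mul_le_mul_of_nonneg_left (ih x) hr)
  have hinv : ∀ n, F ((τ ^ n) x) ((τ ^ n) y) = F x y := fun n => by
    induction n with
    | zero => simp
    | succ n ih =>
      rw [pow_succ']
      exact (hτ _ _).trans ih
  have hC0 : 0 ≤ C := Finset.sum_nonneg fun i _ => Finset.sum_nonneg fun j _ => w.nonneg _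
  have hbd : ∀ n : ℕ, w (F x y) ≤ C * (p x * p y) * r ^ n := fun n => by
    rw [← hinv n]
    refine (hC _ _).trans ?_
    rw [mul_assoc]
    refine mul_le_mul_of_nonneg_left ?_ hC0
    calc p ((τ ^ n) x) * p ((τ ^ n) y) ≤ (r ^ n * p x) * (r ^ n * p y) :=
          mul_le_mul (hpow n x) (hpow n y) (hp0 _) (mul_nonneg (pow_nonneg hr n) (hp0 x))
      _ = p x * p y * r ^ n * r ^ n := by ring
      _ ≤ p x * p y * r ^ n * 1 := mul_le_mul_of_nonneg_left (pow_le_one₀ hr hlt.le)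
          (mul_nonneg (mul_nonneg (hp0 x) (hp0 y)) (pow_nonneg hr n))
      _ = _ := mul_one _
  have hlim := (tendsto_pow_atTop_nhds_zero_of_lt_one hr hlt).const_mul (C * (p x * p y))
  rw [mul_zero] at hlim
  exact hxy (w.eq_zero.1 (le_antisymm (ge_of_tendsto' hlim hbd) (w.nonneg _)))

theorem one_le_finiteLocalHeight_toMatrix' {N : ℕ} (v : FinitePlace K)
    (F : LinearMap.BilinForm K (Fin N → K)) (hF : F ≠ 0)
    (τ : (Fin N → K) →ₗ[K] (Fin N → K)) (hτ : F.IsOrthogonal τ) :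
    1 ≤ finiteLocalHeight v
      (fun p : Fin N × Fin N => LinearMap.toMatrix' τ p.1 p.2) := by
  set A := LinearMap.toMatrix' τ with hA
  have hr := finiteLocalHeight_nonneg v (fun p : Fin N × Fin N => A p.1 p.2)
  refine one_le_of_isOrthogonal (finiteAbs v) F hF τ hτ (finiteLocalHeight v)
    (finiteAbs_le_finiteLocalHeight v) (finiteLocalHeight_nonneg v) hr fun x => ?_
  have h0 := mul_nonneg hr (finiteLocalHeight_nonneg v x)
  refine finiteLocalHeight_le v _ h0 fun i => ?_
  rw [← LinearMap.toMatrix'_mulVec τ x, ← hA]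
  refine finiteAbs_sum_le v Finset.univ (fun j => A i j * x j) h0 fun j _ => ?_
  rw [map_mul]
  exact mul_le_mul (finiteAbs_le_finiteLocalHeight v (fun p : Fin N × Fin N => A p.1 p.2) (i, j))
    (finiteAbs_le_finiteLocalHeight v x j) ((finiteAbs v).nonneg _) hr

/-- By Cauchy–Schwarz the Frobenius norm bounds the operator norm for the Euclidean norm, and an
isometry cannot contract. -/
theorem one_le_sum_infinitePlace_sq_toMatrix' {K : Type*} [Field K] {N : ℕ} (v : InfinitePlace K)
    (F : LinearMap.BilinForm K (Fin N → K)) (hF : F ≠ 0)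
    (τ : (Fin N → K) →ₗ[K] (Fin N → K)) (hτ : F.IsOrthogonal τ) :
    1 ≤ ∑ p : Fin N × Fin N, v (LinearMap.toMatrix' τ p.1 p.2) ^ 2 := by
  set A := LinearMap.toMatrix' τ with hA
  rw [← Real.one_le_sqrt]
  refine one_le_of_isOrthogonal v.1 F hF τ hτ (fun x => √(∑ i, v (x i) ^ 2))
    (fun x i => ?_) (fun x => Real.sqrt_nonneg _) (Real.sqrt_nonneg _) fun x => ?_
  · refine Real.le_sqrt_of_sq_le ?_
    exact Finset.single_le_sum (f := fun i => v (x i) ^ 2) (fun i _ => by positivity)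
      (Finset.mem_univ i)
  · rw [← Real.sqrt_mul (by positivity), Fintype.sum_prod_type, Finset.sum_mul]
    refine Real.sqrt_le_sqrt (Finset.sum_le_sum fun i _ => ?_)
    refine le_trans ?_ (Finset.sum_mul_sq_le_sq_mul_sq _ _ _)
    refine pow_le_pow_left₀ (apply_nonneg v _) ?_ 2
    rw [← LinearMap.toMatrix'_mulVec τ x, ← hA]
    refine (v.1.sum_le Finset.univ fun j => A i j * x j).trans_eq ?_
    exact Finset.sum_congr rfl fun j _ => v.1.map_mul _ _

theorem ne_zero_of_restrict_nondegenerate {N : ℕ} {F : LinearMap.BilinForm K (Fin N → K)}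
    {Z : Submodule K (Fin N → K)} (hZ : 1 ≤ Module.finrank K Z)
    (hreg : (F.restrict Z).Nondegenerate) : F ≠ 0 := by
  rintro rfl
  have := Module.finrank_pos_iff.1 hZ
  obtain ⟨z, hz⟩ := exists_ne (0 : Z)
  exact hz (hreg.1 z fun _ => rfl)

theorem matrix_ne_zero {N : ℕ} {F : LinearMap.BilinForm K (Fin N → K)} (hF : F ≠ 0)
    {τ : (Fin N → K) →ₗ[K] (Fin N → K)} (hτ : F.IsOrthogonal τ) :
    (fun p : Fin N × Fin N => LinearMap.toMatrix' τ p.1 p.2) ≠ 0 := by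
  intro h
  have h1 := one_le_sum_infinitePlace_sq_toMatrix' (Classical.arbitrary (InfinitePlace K)) F hF τ hτ
  have h2 : ∀ p : Fin N × Fin N, LinearMap.toMatrix' τ p.1 p.2 = 0 := congrFun h
  norm_num [h2] at h1

theorem one_le_matrixHeight {N : ℕ} {F : LinearMap.BilinForm K (Fin N → K)} (hF : F ≠ 0)
    {τ : (Fin N → K) →ₗ[K] (Fin N → K)} (hτ : F.IsOrthogonal τ) :
    1 ≤ matrixHeight (LinearMap.toMatrix' τ) :=
  one_le_vecHeight (matrix_ne_zero hF hτ)
    (fun v => one_le_sum_infinitePlace_sq_toMatrix' v F hF τ hτ)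
    fun v => one_le_finiteLocalHeight_toMatrix' v F hF τ hτ

/-! ### Rows of `A - 1` and the invariant subspace -/

theorem sum_infinitePlace_sub_single_sq_le {K : Type*} [Field K] {N : ℕ} (v : InfinitePlace K)
    (a : Fin N → K) (i : Fin N) {S : ℝ} (hS : 1 ≤ S) (ha : ∑ j, v (a j) ^ 2 ≤ S) :
    ∑ j, v ((a - Pi.single i 1 : Fin N → K) j) ^ 2 ≤ 2 ^ 2 * S := by
  have h : ∀ j, v ((a - Pi.single i 1 : Fin N → K) j) ^ 2 ≤
      v (a j) ^ 2 + if j = i then 2 * v (a i) + 1 else 0 := fun j => by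
    by_cases hj : j = i
    · subst hj
      have h1 : v (a j - 1) ≤ v (a j) + 1 := by
        have := v.1.add_le (a j) (-1)
        rwa [v.1.map_neg, v.1.map_one, ← sub_eq_add_neg] at this
      have h2 := apply_nonneg v (a j - 1)
      simp only [Pi.sub_apply, Pi.single_eq_same, if_true]
      nlinarith
    · simp [hj]
  have h1 : v (a i) ^ 2 ≤ S := (Finset.single_le_sum (f := fun i => v (a i) ^ 2)
      (fun i _ => by positivity) (Finset.mem_univ i)).trans ha
  have h2 := Finset.sum_le_sum fun j (_ : j ∈ Finset.univ) => h j
  rw [Finset.sum_add_distrib, Finset.sum_ite_eq' Finset.univ i, if_pos (Finset.mem_univ i)] at h2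
  -- With `t = v (a i)`: `S + 2t + 1 ≤ S + t² + 2 ≤ 2S + 2 ≤ 4S`, the last step using `1 ≤ S`.
  nlinarith [sq_nonneg (v (a i) - 1)]

/-- The factor 2 arises only at infinite places; at finite ones `|a - 1| ≤ max(|a|, 1)`, and 1 is
absorbed by the local height of the matrix. -/
theorem vecHeight_row_sub_single_le {N : ℕ} {F : LinearMap.BilinForm K (Fin N → K)} (hF : F ≠ 0)
    {τ : (Fin N → K) →ₗ[K] (Fin N → K)} (hτ : F.IsOrthogonal τ) (i : Fin N)
    (h0 : LinearMap.toMatrix' τ i - Pi.single i 1 ≠ 0) :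
    vecHeight (LinearMap.toMatrix' τ i - Pi.single i 1) ≤
      2 * matrixHeight (LinearMap.toMatrix' τ) := by
  refine vecHeight_le_const_mul zero_le_two h0 (matrix_ne_zero hF hτ) (fun v => ?_) fun v => ?_
  · refine sum_infinitePlace_sub_single_sq_le v _ i
      (one_le_sum_infinitePlace_sq_toMatrix' v F hF τ hτ) ?_
    rw [Fintype.sum_prod_type]
    exact Finset.single_le_sum (f := fun i => ∑ j, v (LinearMap.toMatrix' τ i j) ^ 2)
      (fun i _ => by positivity) (Finset.mem_univ i)
  · have h1 := one_le_finiteLocalHeight_toMatrix' v F hF τ hτ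
    refine finiteLocalHeight_le v _ (zero_le_one.trans h1) fun j => ?_
    have h2 := finiteAbs_le_finiteLocalHeight v
      (fun p : Fin N × Fin N => LinearMap.toMatrix' τ p.1 p.2) (i, j)
    by_cases hj : j = i
    · subst hj
      have h3 := isNonarchimedean_finiteAbs v (LinearMap.toMatrix' τ j j) (-1)
      rw [(finiteAbs v).map_neg, map_one, ← sub_eq_add_neg] at h3
      rw [Pi.sub_apply, Pi.single_eq_same]
      exact h3.trans (max_le h2 h1)
    · rwa [Pi.sub_apply, Pi.single_eq_of_ne hj, sub_zero]

theorem invariantSubspace_eq {k : Type*} [Field k] {N : ℕ} {F : LinearMap.BilinForm k (Fin N → k)}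
    {Z : Submodule k (Fin N → k)} {σ : Z ≃ₗ[k] Z} {τ : (Fin N → k) ≃ₗ[k] (Fin N → k)}
    (h : IsIsometricExtension F Z σ τ) :
    invariantSubspace Z σ = Z ⊓ Finset.univ.inf fun i => LinearMap.ker
      (dotProductBilin k k (LinearMap.toMatrix' τ.toLinearMap i - Pi.single i 1)) := by
  ext x
  have hx : ∀ i, (LinearMap.toMatrix' τ.toLinearMap i - Pi.single i 1) ⬝ᵥ x = τ x i - x i :=
    fun i => by
      rw [sub_dotProduct, single_dotProduct, one_mul]
      exact congrArg (· - x i) (congrFun (LinearMap.toMatrix'_mulVec τ.toLinearMap x) i)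
  simp only [invariantSubspace, Submodule.mem_map, LinearMap.mem_eqLocus, Submodule.mem_inf,
    Submodule.mem_finsetInf, Finset.mem_univ, true_implies, LinearMap.mem_ker,
    dotProductBilin_apply_apply, hx, sub_eq_zero]
  constructor
  · rintro ⟨z, hz, rfl⟩
    refine ⟨z.2, fun i => ?_⟩
    have h1 : σ z = z := hz
    rw [Submodule.subtype_apply, h.2, h1]
  · rintro ⟨hxZ, hx⟩
    exact ⟨⟨x, hxZ⟩, Subtype.ext ((h.2 ⟨x, hxZ⟩).symm.trans (funext hx)), rfl⟩

theorem subspaceHeight_invariantSubspace_le {N : ℕ} {F : LinearMap.BilinForm K (Fin N → K)}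
    (hF : F ≠ 0) {Z : Submodule K (Fin N → K)} {σ : Z ≃ₗ[K] Z}
    {τ : (Fin N → K) ≃ₗ[K] (Fin N → K)} (h : IsIsometricExtension F Z σ τ) :
    subspaceHeight (invariantSubspace Z σ) ≤
      (2 * matrixHeight (LinearMap.toMatrix' τ.toLinearMap)) ^
          (N - Module.finrank K (invariantSubspace Z σ)) * subspaceHeight Z := by
  obtain ⟨m, hm, hle⟩ := subspaceHeight_inf_iInf_ker_le Z
    (fun i => LinearMap.toMatrix' τ.toLinearMap i - Pi.single i 1)
    (fun i => vecHeight_row_sub_single_le hF h.1 i) Finset.univ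
  rw [← invariantSubspace_eq h] at hm hle
  have hN : Module.finrank K Z ≤ N := by simpa using Z.finrank_le
  have h1 := one_le_matrixHeight hF h.1
  -- Here `m = L - J ≤ N - J`, and the base is at least 1.
  exact hle.trans (mul_le_mul_of_nonneg_right
    (pow_le_pow_right₀ (by linarith) (by omega)) (subspaceHeight_nonneg Z))

end BilinearHeight

end

theorem mainTheorem6 {K : Type*} [Field K] [NumberField K] {N : ℕ} (hN : 2 ≤ N)
    (F : LinearMap.BilinForm K (Fin N → K)) (hF : F.IsSymm)
    (Z : Submodule K (Fin N → K)) (hZ : 1 ≤ Module.finrank K Z)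
    (hreg : (F.restrict Z).Nondegenerate)
    (σ : Z ≃ₗ[K] Z) (hσ : (F.restrict Z).IsOrthogonal σ.toLinearMap) :
    BilinearHeight.subspaceHeight (BilinearHeight.invariantSubspace Z σ) ≤
      (2 * BilinearHeight.isometryHeight F Z σ) ^
          (N - Module.finrank K (BilinearHeight.invariantSubspace Z σ)) *
        BilinearHeight.subspaceHeight Z := by
  obtain ⟨τ, hτ⟩ := BilinearHeight.exists_isometricExtension F hF Z hreg σ hσ
  have hF0 := BilinearHeight.ne_zero_of_restrict_nondegenerate hZ hreg
  -- The bound is a closed condition on `h`, so it passes to the infimum whether or not that is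
  -- attained.
  have hclosed : IsClosed {h : ℝ | BilinearHeight.subspaceHeight
      (BilinearHeight.invariantSubspace Z σ) ≤
        (2 * h) ^ (N - Module.finrank K (BilinearHeight.invariantSubspace Z σ)) *
          BilinearHeight.subspaceHeight Z} :=
    isClosed_le continuous_const (by fun_prop)
  refine closure_minimal ?_ hclosed (csInf_mem_closure ⟨_, τ, hτ, rfl⟩ ⟨0, ?_⟩)
  · rintro _ ⟨τ', hτ', rfl⟩
    exact BilinearHeight.subspaceHeight_invariantSubspace_le hF0 hτ'
  · rintro _ ⟨τ', -, rfl⟩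
    exact BilinearHeight.vecHeight_nonneg _
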